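/- Let $m\ge 3$. Let $Spin_m$ be the compact spin group, that is, the group of products of an even number of unit vectors in the real Clifford algebra of $\mathbb{R}^m$ with the relation $v^2=-\|v\|^2$, and let $\pi\colon Spin_m\to SO_m$, $\pi(x)v=xvx^{-1}$, be the standard double covering, with kernel $\{\pm 1\}$. Let $V$ be a finite-dimensional complex vector space and let $\rho\colon Spin_m\to GL(V)$ be a continuous irreducible representation which does not factor through $SO_m$, i.e., there is no continuous representation $\sigma\colon SO_m\to GL(V)$ with $\rho=\sigma\circ\pi$. Then $\dim_{\mathbb{C}}V$ is even. -/

import Mathlib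

open CliffordAlgebra

/-- The negative definite quadratic form `v ↦ -(v₁² + ⋯ + v_m²)` on `ℝ^m`. -/
noncomputable abbrev spinForm (m : ℕ) : QuadraticForm ℝ (Fin m → ℝ) :=
  QuadraticMap.weightedSumSquares ℝ (fun _ : Fin m => (-1 : ℝ))

/-- The compact spin group `Spin_m`, inside the real Clifford algebra of `ℝ^m` with the
convention `v² = -‖v‖²`. -/
abbrev Spin (m : ℕ) : Type := spinGroup (spinForm m)

/-- The topology on `Spin_m` is the subspace topology from the Clifford algebra, which carries the
canonical topology of a finite-dimensional real vector space. -/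
noncomputable instance Spin.instTopologicalSpace (m : ℕ) : TopologicalSpace (Spin m) :=
  (moduleTopology ℝ (CliffordAlgebra (spinForm m))).induced Subtype.val

/-- The special orthogonal group `SO_m`, as real `m × m` matrices (with the subspace topology). -/
abbrev SO (m : ℕ) : Type := Matrix.specialOrthogonalGroup (Fin m) ℝ

namespace Spin

/-- The linear projection of the Clifford algebra onto its vectors, a left inverse of `ι`. -/
noncomputable def vectorPart (m : ℕ) : CliffordAlgebra (spinForm m) →ₗ[ℝ] (Fin m → ℝ) :=
  ExteriorAlgebra.ιInv ∘ₗ (equivExterior (spinForm m)).toLinearMap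

theorem vectorPart_ι (m : ℕ) (v : Fin m → ℝ) : vectorPart m (ι (spinForm m) v) = v := by
  simp only [vectorPart, LinearMap.comp_apply, LinearEquiv.coe_coe]
  have h : equivExterior (spinForm m) (ι (spinForm m) v) = ExteriorAlgebra.ι ℝ v := by
    simp [equivExterior]
  rw [h]
  exact ExteriorAlgebra.ι_leftInverse v

theorem ι_injective (m : ℕ) : Function.Injective (ι (spinForm m)) :=
  Function.LeftInverse.injective (vectorPart_ι m)

/-- The matrix of the linear map `v ↦ a v b` of `ℝ^m` (followed by projection to vectors). -/
noncomputable def sandwich (m : ℕ) (a b : CliffordAlgebra (spinForm m)) :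
    Matrix (Fin m) (Fin m) ℝ :=
  LinearMap.toMatrix' (vectorPart m ∘ₗ LinearMap.mulLeft ℝ a ∘ₗ LinearMap.mulRight ℝ b ∘ₗ
    ι (spinForm m))

theorem sandwich_mulVec (m : ℕ) (a b : CliffordAlgebra (spinForm m)) (v : Fin m → ℝ) :
    (sandwich m a b).mulVec v = vectorPart m (a * ι (spinForm m) v * b) := by
  rw [sandwich, LinearMap.toMatrix'_mulVec]
  simp [mul_assoc]

theorem sandwich_eq (m : ℕ) (a b : CliffordAlgebra (spinForm m)) (A : Matrix (Fin m) (Fin m) ℝ)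
    (h : ∀ v, ι (spinForm m) (A.mulVec v) = a * ι (spinForm m) v * b) : sandwich m a b = A := by
  apply Matrix.toLin'.injective
  ext1 i
  ext1
  simp only [LinearMap.comp_apply, Matrix.toLin'_apply, sandwich_mulVec, ← h, vectorPart_ι]

theorem ι_sandwich (m : ℕ) (x : CliffordAlgebra (spinForm m)) (hx : x ∈ spinGroup (spinForm m))
    (v : Fin m → ℝ) :
    ι (spinForm m) ((sandwich m x (star x)).mulVec v) = x * ι (spinForm m) v * star x := by
  let u : (CliffordAlgebra (spinForm m))ˣ := spinGroup.toUnits ⟨x, hx⟩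
  obtain ⟨w, hw⟩ := spinGroup.conjAct_smul_ι_mem_range_ι (x := u) hx v
  have hw' : ι (spinForm m) w = x * ι (spinForm m) v * star x := hw
  rw [sandwich_mulVec, ← hw', vectorPart_ι]

/-- Twisted conjugation by an element of the Lipschitz group has determinant `±1`, and the sign
tells the parity of the element. -/
theorem det_twisted (m : ℕ) (x : (CliffordAlgebra (spinForm m))ˣ)
    (hx : x ∈ lipschitzGroup (spinForm m)) :
    ((sandwich m (involute (x : CliffordAlgebra (spinForm m))) ↑x⁻¹).det = 1 ∧
      involute (x : CliffordAlgebra (spinForm m)) = x) ∨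
    ((sandwich m (involute (x : CliffordAlgebra (spinForm m))) ↑x⁻¹).det = -1 ∧
      involute (x : CliffordAlgebra (spinForm m)) = -x) := by
  have hι : ∀ y ∈ lipschitzGroup (spinForm m), ∀ v,
      ι (spinForm m) ((sandwich m (involute (y : CliffordAlgebra (spinForm m))) ↑y⁻¹).mulVec v) =
        involute (y : CliffordAlgebra (spinForm m)) * ι (spinForm m) v * ↑y⁻¹ := by
    intro y hy v
    obtain ⟨w, hw⟩ := lipschitzGroup.involute_act_ι_mem_range_ι hy v
    rw [sandwich_mulVec, ← hw, vectorPart_ι]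
  have hmul : ∀ y ∈ lipschitzGroup (spinForm m), ∀ z ∈ lipschitzGroup (spinForm m),
      sandwich m (involute ((y * z : (CliffordAlgebra (spinForm m))ˣ) :
          CliffordAlgebra (spinForm m))) ↑(y * z)⁻¹ =
        sandwich m (involute (y : CliffordAlgebra (spinForm m))) ↑y⁻¹ *
        sandwich m (involute (z : CliffordAlgebra (spinForm m))) ↑z⁻¹ := by
    intro y hy z hz
    apply sandwich_eq
    intro v
    rw [← Matrix.mulVec_mulVec, hι y hy, hι z hz]
    simp [mul_assoc]
  induction hx using Subgroup.closure_induction with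
  | one =>
    left
    have : sandwich m (involute ((1 : (CliffordAlgebra (spinForm m))ˣ) :
        CliffordAlgebra (spinForm m))) ↑(1 : (CliffordAlgebra (spinForm m))ˣ)⁻¹ = 1 := by
      apply sandwich_eq
      simp
    rw [this]
    simp
  | mem x hx =>
    right
    obtain ⟨a, ha⟩ := hx
    refine ⟨?_, by rw [← ha, involute_ι]⟩
    let := x.invertible
    let : Invertible (ι (spinForm m) a) := by rwa [ha]
    let : Invertible (spinForm m a) := invertibleOfInvertibleι (spinForm m) a
    have h : sandwich m (involute (x : CliffordAlgebra (spinForm m))) ↑x⁻¹ =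
        1 + Matrix.replicateCol Unit a *
          Matrix.replicateRow Unit ((2 * ⅟(spinForm m a)) • a) := by
      apply sandwich_eq
      intro v
      rw [← invOf_units x]
      simp_rw [← ha, involute_ι, neg_mul, ι_mul_ι_mul_invOf_ι (spinForm m) a v, ← map_neg]
      congr 1
      have hp : QuadraticMap.polar (spinForm m) a v = - (2 * (a ⬝ᵥ v)) := by
        simp only [QuadraticMap.polar, QuadraticMap.weightedSumSquares_apply, dotProduct,
          Pi.add_apply, smul_eq_mul, Finset.mul_sum]
        rw [← Finset.sum_sub_distrib, ← Finset.sum_sub_distrib, ← Finset.sum_neg_distrib]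
        exact Finset.sum_congr rfl fun i _ => by ring
      have hr : (Matrix.replicateRow Unit ((2 * ⅟(spinForm m a)) • a)).mulVec v =
          fun _ => (2 * ⅟(spinForm m a)) * (a ⬝ᵥ v) := by
        ext
        change ((2 * ⅟(spinForm m a)) • a) ⬝ᵥ v = _
        rw [smul_dotProduct, smul_eq_mul]
      rw [hp, Matrix.add_mulVec, Matrix.one_mulVec, ← Matrix.mulVec_mulVec, hr]
      ext i
      simp only [Pi.add_apply, Pi.neg_apply, Pi.sub_apply, Pi.smul_apply, smul_eq_mul,
        Matrix.mulVec, dotProduct, Matrix.replicateCol_apply, Finset.univ_unique,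
        Finset.sum_singleton]
      ring
    rw [h, Matrix.det_one_add_replicateCol_mul_replicateRow, smul_dotProduct]
    have hq : a ⬝ᵥ a = - spinForm m a := by
      simp [QuadraticMap.weightedSumSquares_apply, dotProduct]
    rw [hq, smul_eq_mul, mul_neg, mul_assoc, invOf_mul_self]
    norm_num
  | mul y z hy hz ihy ihz =>
    rw [hmul y hy z hz, Matrix.det_mul, Units.val_mul, map_mul]
    rcases ihy with ⟨h1, h2⟩ | ⟨h1, h2⟩ <;> rcases ihz with ⟨h3, h4⟩ | ⟨h3, h4⟩ <;>
      rw [h1, h2, h3, h4] <;> simp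
  | inv y hy ih =>
    have h1 := hmul y⁻¹ (inv_mem hy) y hy
    have h2 : sandwich m (involute (((y⁻¹ * y) : (CliffordAlgebra (spinForm m))ˣ) :
        CliffordAlgebra (spinForm m))) ↑(y⁻¹ * y)⁻¹ = 1 := by
      apply sandwich_eq
      simp
    rw [h2] at h1
    have h3 := congrArg Matrix.det h1
    rw [Matrix.det_mul, Matrix.det_one] at h3
    have h4 : involute (((y⁻¹ * y) : (CliffordAlgebra (spinForm m))ˣ) :
        CliffordAlgebra (spinForm m)) = 1 := by simp
    rw [Units.val_mul, map_mul] at h4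
    rcases ih with ⟨h5, h6⟩ | ⟨h5, h6⟩
    · left
      rw [h5] at h3
      rw [h6] at h4
      exact ⟨by linarith, Units.eq_inv_of_mul_eq_one_right h4⟩
    · right
      rw [h5] at h3
      rw [h6, mul_neg, ← neg_mul] at h4
      refine ⟨by linarith, ?_⟩
      exact neg_eq_iff_eq_neg.mp (Units.eq_inv_of_mul_eq_one_right h4)

theorem det_sandwich (m : ℕ) (x : CliffordAlgebra (spinForm m)) (hx : x ∈ spinGroup (spinForm m)) :
    (sandwich m x (star x)).det = 1 := by
  let u : (CliffordAlgebra (spinForm m))ˣ := spinGroup.toUnits ⟨x, hx⟩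
  have hu : involute (u : CliffordAlgebra (spinForm m)) = u := spinGroup.involute_eq hx
  rcases det_twisted m u (spinGroup.units_mem_lipschitzGroup (x := u) hx) with ⟨h, -⟩ | ⟨-, h⟩
  · rw [hu] at h
    exact h
  · exfalso
    rw [hu] at h
    have h2 : (2 : ℝ) • (u : CliffordAlgebra (spinForm m)) = 0 := by
      rw [two_smul]
      nth_rewrite 1 [h]
      simp
    have h3 := (smul_eq_zero.mp h2).resolve_left two_ne_zero
    exact u.ne_zero h3

theorem spinForm_eq (m : ℕ) (v : Fin m → ℝ) : spinForm m v = - (v ⬝ᵥ v) := by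
  simp [QuadraticMap.weightedSumSquares_apply, dotProduct]

theorem sandwich_mem (m : ℕ) (x : CliffordAlgebra (spinForm m)) (hx : x ∈ spinGroup (spinForm m)) :
    sandwich m x (star x) ∈ Matrix.specialOrthogonalGroup (Fin m) ℝ := by
  rw [Matrix.mem_specialOrthogonalGroup_iff]
  refine ⟨?_, det_sandwich m x hx⟩
  rw [Matrix.mem_orthogonalGroup_iff']
  set A := sandwich m x (star x) with hA
  have hQ : ∀ v, A.mulVec v ⬝ᵥ A.mulVec v = v ⬝ᵥ v := by
    intro v
    have h : algebraMap ℝ (CliffordAlgebra (spinForm m)) (spinForm m (A.mulVec v)) =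
        algebraMap ℝ (CliffordAlgebra (spinForm m)) (spinForm m v) := by
      rw [← ι_sq_scalar, hA, ι_sandwich m x hx]
      calc x * ι (spinForm m) v * star x * (x * ι (spinForm m) v * star x)
          = x * ι (spinForm m) v * (star x * x) * ι (spinForm m) v * star x := by
            simp only [mul_assoc]
        _ = x * (ι (spinForm m) v * ι (spinForm m) v) * star x := by
            rw [spinGroup.star_mul_self_of_mem hx]
            simp only [mul_assoc, one_mul]
        _ = algebraMap ℝ (CliffordAlgebra (spinForm m)) (spinForm m v) := by
            rw [ι_sq_scalar, ← Algebra.commutes, mul_assoc,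
              spinGroup.mul_star_self_of_mem hx, mul_one]
    have h' := FaithfulSMul.algebraMap_injective ℝ (CliffordAlgebra (spinForm m)) h
    rw [spinForm_eq, spinForm_eq] at h'
    linarith
  have hB : ∀ v w, A.mulVec v ⬝ᵥ A.mulVec w = v ⬝ᵥ w := by
    intro v w
    have h1 := hQ (v + w)
    simp only [Matrix.mulVec_add, add_dotProduct, dotProduct_add] at h1
    have h2 := dotProduct_comm (A.mulVec v) (A.mulVec w)
    have h3 := dotProduct_comm v w
    linarith [hQ v, hQ w]
  ext i j
  have h := hB (Pi.single i 1) (Pi.single j 1)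
  rw [Matrix.mulVec_single_one, Matrix.mulVec_single_one] at h
  rw [Matrix.mul_apply]
  simpa [dotProduct, Matrix.one_apply, Pi.single_apply, eq_comm] using h

/-- The standard covering homomorphism `Spin_m → SO_m`: the element `x` acts on the vectors of
`ℝ^m` by `v ↦ x v x⁻¹` (recall `x⁻¹ = star x` in the spin group). -/
noncomputable def toSO (m : ℕ) : Spin m →* SO m where
  toFun x := ⟨sandwich m x (star (x : CliffordAlgebra (spinForm m))), sandwich_mem m x x.2⟩
  map_one' := by
    apply Subtype.ext
    apply sandwich_eq
    simp
  map_mul' x y := by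
    apply Subtype.ext
    apply sandwich_eq
    intro v
    change ι (spinForm m) (Matrix.mulVec (sandwich m x (star (x : CliffordAlgebra (spinForm m))) *
      sandwich m y (star (y : CliffordAlgebra (spinForm m)))) v) = _
    rw [← Matrix.mulVec_mulVec, ι_sandwich m x x.2, ι_sandwich m y y.2]
    simp [mul_assoc]

/-- The defining property of the covering homomorphism. -/
theorem ι_toSO_mulVec (m : ℕ) (x : Spin m) (v : Fin m → ℝ) :
    ι (spinForm m) ((toSO m x : Matrix (Fin m) (Fin m) ℝ).mulVec v) =
      (x : CliffordAlgebra (spinForm m)) * ι (spinForm m) v *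
        ((x⁻¹ : Spin m) : CliffordAlgebra (spinForm m)) :=
  ι_sandwich m x x.2 v

end Spin

/-- A complex representation of a topological group on a topological vector space is continuous
if all its orbit maps are; on a finite-dimensional Hausdorff space this is continuity of
`G → GL(V)`. -/
def Representation.IsContinuousRep {G V : Type*} [Group G] [TopologicalSpace G] [AddCommGroup V]
    [Module ℂ V] [TopologicalSpace V] (ρ : Representation ℂ G V) : Prop :=
  ∀ v : V, Continuous fun g : G => ρ g v

/-- A representation of `Spin_m` factors through `SO_m` if it is the pullback of a continuous
representation of `SO_m` along the covering homomorphism. -/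
def Spin.FactorsThroughSO {m : ℕ} {V : Type*} [AddCommGroup V] [Module ℂ V] [TopologicalSpace V]
    (ρ : Representation ℂ (Spin m) V) : Prop :=
  ∃ σ : Representation ℂ (SO m) V, σ.IsContinuousRep ∧ ∀ x : Spin m, ρ x = σ (Spin.toSO m x)

/-! The element -1 of `Spin m` is a central involution, so it acts on an irreducible representation
as 1 or -1. If it acts as 1, then `ρ` is trivial on the kernel of the covering and descends to `SO
m`, which is excluded. So it acts as -1. For orthonormal vectors e₀, e₁, e₂, which exist since m ≥
3, the spin elements e₀e₁ and e₁e₂ commute up to the factor -1. Their images under `ρ` are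
invertible and anticommute, and comparing determinants gives (-1)^dim V = 1.

The work lies in the descent. That the kernel is at most {±1}
(`eq_one_or_eq_neg_one_of_toSO_eq_one`) follows by moving to the exterior algebra: an even element
commuting with all vectors is killed by all contractions, hence scalar. Continuity of the descended
representation (`factorsThroughSO_of_ker`) rests on Cartan–Dieudonné: `SO m` is a quotient of a
compact space of tuples of unit vectors, by a map that lifts continuously to `Spin m`. -/

section Contraction

/-! ### Contractions and scalars in Clifford and exterior algebras -/

variable {R M : Type*} [CommRing R] [AddCommGroup M] [Module R M]

/-- The twisted commutator with a vector is the contraction with the polar form. -/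
theorem CliffordAlgebra.ι_mul_sub_involute_mul_ι (Q : QuadraticForm R M) (v : M)
    (x : CliffordAlgebra Q) :
    ι Q v * x - involute x * ι Q v = contractLeft (Q.polarBilin v) x := by
  induction x using CliffordAlgebra.left_induction with
  | algebraMap r => simp [Algebra.commutes]
  | add x y hx hy =>
    rw [map_add (contractLeft _), ← hx, ← hy, map_add]
    noncomm_ring
  | ι_mul x a hx =>
    have h : ι Q v * ι Q a = algebraMap R _ (QuadraticMap.polar Q v a) - ι Q a * ι Q v := by
      rw [← ι_mul_ι_add_swap, add_sub_cancel_right]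
    rw [contractLeft_ι_mul, ← hx, map_mul, involute_ι, ← mul_assoc, h, Algebra.smul_def]
    simp only [QuadraticMap.polarBilin_apply_apply]
    noncomm_ring

/-- An exterior element that is annihilated by all contractions is a scalar. -/
theorem ExteriorAlgebra.mem_range_algebraMap_of_contractLeft_eq_zero {K ι₀ : Type*} [Field K]
    [CharZero K] [Module K M] [Fintype ι₀] (b : Module.Basis ι₀ K M) (x : ExteriorAlgebra K M)
    (hx : ∀ i, contractLeft (Q := (0 : QuadraticForm K M)) (b.coord i) x = 0) :
    x ∈ (algebraMap K (ExteriorAlgebra K M)).range := by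
  classical
  -- The Euler operator ∑ eᵢ ∧ (eᵢ* ⌟ ·): it multiplies degree n by n and kills `x`, so in
  -- characteristic zero only the degree 0 part of `x` survives.
  let E : ExteriorAlgebra K M →ₗ[K] ExteriorAlgebra K M :=
    ∑ i, LinearMap.mulLeft K (ExteriorAlgebra.ι K (b i)) ∘ₗ
      contractLeft (Q := (0 : QuadraticForm K M)) (b.coord i)
  have hE : ∀ y, E y = ∑ i, ExteriorAlgebra.ι K (b i) *
      contractLeft (Q := (0 : QuadraticForm K M)) (b.coord i) y := by
    intro y
    simp [E]
  have hEι : ∀ (a : M) (y : ExteriorAlgebra K M),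
      E (ExteriorAlgebra.ι K a * y) = ExteriorAlgebra.ι K a * y + ExteriorAlgebra.ι K a * E y := by
    intro a y
    have hterm : ∀ i, ExteriorAlgebra.ι K (b i) * contractLeft (Q := (0 : QuadraticForm K M))
        (b.coord i) (ExteriorAlgebra.ι K a * y) =
        (ExteriorAlgebra.ι K (b.coord i a • b i)) * y + ExteriorAlgebra.ι K a *
          (ExteriorAlgebra.ι K (b i) *
            contractLeft (Q := (0 : QuadraticForm K M)) (b.coord i) y) := by
      intro i
      have h1 : contractLeft (Q := (0 : QuadraticForm K M)) (b.coord i)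
          (ExteriorAlgebra.ι K a * y) = b.coord i a • y - ExteriorAlgebra.ι K a *
            contractLeft (Q := (0 : QuadraticForm K M)) (b.coord i) y :=
        contractLeft_ι_mul (Q := (0 : QuadraticForm K M)) (d := b.coord i) a y
      have h2 : ExteriorAlgebra.ι K (b i) * ExteriorAlgebra.ι K a =
          -(ExteriorAlgebra.ι K a * ExteriorAlgebra.ι K (b i)) :=
        eq_neg_of_add_eq_zero_left (ExteriorAlgebra.ι_add_mul_swap (b i) a)
      rw [h1, mul_sub, ← mul_assoc, h2, map_smul, mul_smul_comm, smul_mul_assoc, neg_mul,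
        sub_neg_eq_add, mul_assoc]
    rw [hE, hE, Finset.sum_congr rfl fun i _ => hterm i, Finset.sum_add_distrib,
      ← Finset.sum_mul, ← map_sum, ← Finset.mul_sum]
    congr 4
    exact b.sum_repr a
  have hdeg : ∀ (n : ℕ) (y : ExteriorAlgebra K M), y ∈ ⋀[K]^n M → E y = n • y := by
    intro n y hy
    induction hy using Submodule.pow_induction_on_left' with
    | algebraMap r =>
      rw [hE, zero_smul]
      refine Finset.sum_eq_zero fun i _ => ?_
      have h : contractLeft (Q := (0 : QuadraticForm K M)) (b.coord i)
        (algebraMap K (ExteriorAlgebra K M) r) = 0 :=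
        contractLeft_algebraMap (Q := (0 : QuadraticForm K M)) (b.coord i) r
      rw [h, mul_zero]
    | add y z i _ _ hy hz => rw [map_add, hy, hz, smul_add]
    | mem_mul m hm i y _ ih =>
      obtain ⟨a, rfl⟩ := hm
      rw [hEι, ih, mul_smul_comm, succ_nsmul']
  have hEx : E x = 0 := by
    rw [hE]
    exact Finset.sum_eq_zero fun i _ => by rw [hx, mul_zero]
  let D := DirectSum.decompose (fun i : ℕ => ⋀[K]^i M)
  have hEdec : ∀ n, ((D (E x)) n : ExteriorAlgebra K M) = n • ((D x) n : ExteriorAlgebra K M) := by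
    intro n
    have h1 : E x = ∑ i ∈ (D x).support, i • ((D x) i : ExteriorAlgebra K M) := by
      conv_lhs => rw [← DirectSum.sum_support_decompose (fun i : ℕ => ⋀[K]^i M) x]
      rw [map_sum]
      exact Finset.sum_congr rfl fun i _ => hdeg i _ (SetLike.coe_mem _)
    rw [h1, DirectSum.decompose_sum, DFinsupp.finsetSum_apply, AddSubmonoidClass.coe_finsetSum]
    have h2 : ∀ i, ((D (i • ((D x) i : ExteriorAlgebra K M)) n : ⋀[K]^n M) : ExteriorAlgebra K M) =
        if i = n then n • ((D x) n : ExteriorAlgebra K M) else 0 := by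
      intro i
      split_ifs with h
      · subst h
        exact DirectSum.decompose_of_mem_same _ (Submodule.smul_of_tower_mem _ _ (SetLike.coe_mem _))
      · exact DirectSum.decompose_of_mem_ne _
          (Submodule.smul_of_tower_mem _ _ (SetLike.coe_mem _)) h
    refine (Finset.sum_congr rfl fun i _ => h2 i).trans ?_
    rw [Finset.sum_ite_eq']
    split_ifs with h
    · rfl
    · rw [DFinsupp.notMem_support_iff.mp h]
      simp
  have hzero : ∀ n, n ≠ 0 → ((D x) n : ExteriorAlgebra K M) = 0 := by
    intro n hn
    have h := hEdec n
    rw [hEx, ← Nat.cast_smul_eq_nsmul K] at h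
    have h0 : ((D 0) n : ExteriorAlgebra K M) = 0 := by simp [D]
    rw [h0] at h
    exact (smul_eq_zero.mp h.symm).resolve_left (Nat.cast_ne_zero.mpr hn)
  have hx0 : x = ((D x) 0 : ExteriorAlgebra K M) := by
    conv_lhs => rw [← DirectSum.sum_support_decompose (fun i : ℕ => ⋀[K]^i M) x]
    refine Finset.sum_eq_single 0 (fun n _ hn => hzero n hn) fun h => ?_
    rw [DFinsupp.notMem_support_iff.mp h]
    rfl
  have hmem : x ∈ ⋀[K]^0 M := hx0 ▸ SetLike.coe_mem _
  exact Submodule.mem_one.mp ((Submodule.pow_zero (LinearMap.range (ExteriorAlgebra.ι K))).le hmem)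

end Contraction

/-! ### The kernel of the covering -/

namespace Spin

theorem polar_spinForm (m : ℕ) (v w : Fin m → ℝ) :
    QuadraticMap.polar (spinForm m) v w = -2 * (v ⬝ᵥ w) := by
  rw [QuadraticMap.polar, spinForm_eq, spinForm_eq, spinForm_eq, add_dotProduct, dotProduct_add,
    dotProduct_add, dotProduct_comm w v]
  ring

/-- An even Clifford element that commutes with all vectors is a scalar. -/
theorem exists_algebraMap_eq_of_commute (m : ℕ) (x : CliffordAlgebra (spinForm m))
    (hx : involute x = x) (hcomm : ∀ v, ι (spinForm m) v * x = x * ι (spinForm m) v) :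
    ∃ c : ℝ, algebraMap ℝ _ c = x := by
  -- The polar form is -2⟨v, w⟩, so the vector -eᵢ/2 represents the i-th coordinate functional.
  have hpolar : ∀ i, (spinForm m).polarBilin (Pi.single i (-2⁻¹)) =
      (Pi.basisFun ℝ (Fin m)).coord i := by
    intro i
    apply LinearMap.ext
    intro v
    rw [QuadraticMap.polarBilin_apply_apply, polar_spinForm, single_dotProduct]
    simp
  obtain ⟨c, hc⟩ := ExteriorAlgebra.mem_range_algebraMap_of_contractLeft_eq_zero
    (Pi.basisFun ℝ (Fin m)) (equivExterior (spinForm m) x) (by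
      intro i
      -- Evenness of `x` turns the twisted commutator into the ordinary one, which vanishes. The
      -- linear isomorphism with the exterior algebra respects contractions.
      have h := ι_mul_sub_involute_mul_ι (spinForm m) (Pi.single i (-2⁻¹)) x
      rw [hx, hcomm, sub_self, hpolar] at h
      have h2 := changeForm_contractLeft (changeForm.associated_neg_proof (Q := spinForm m))
        ((Pi.basisFun ℝ (Fin m)).coord i) x
      rw [← h, map_zero] at h2
      exact h2.symm)
  refine ⟨c, (equivExterior (spinForm m)).injective ?_⟩
  rw [← hc]
  exact changeForm_algebraMap (changeForm.associated_neg_proof (Q := spinForm m)) c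

/-- The kernel of the covering homomorphism is contained in `{±1}`. -/
theorem eq_one_or_eq_neg_one_of_toSO_eq_one {m : ℕ} {x : Spin m} (hx : toSO m x = 1) :
    (x : CliffordAlgebra (spinForm m)) = 1 ∨ (x : CliffordAlgebra (spinForm m)) = -1 := by
  obtain ⟨c, hc⟩ := exists_algebraMap_eq_of_commute m x (spinGroup.involute_eq x.2) (by
    intro v
    have h : ι (spinForm m) v = x * ι (spinForm m) v * star (x : CliffordAlgebra (spinForm m)) := by
      have h1 := ι_toSO_mulVec m x v
      rw [hx, OneMemClass.coe_one, Matrix.one_mulVec] at h1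
      exact h1
    nth_rewrite 1 [h]
    rw [mul_assoc, spinGroup.star_mul_self_of_mem x.2, mul_one])
  -- `star` fixes scalars, so the relation x · star x = 1 reads c² = 1.
  have h1 := spinGroup.mul_star_self_of_mem x.2
  rw [← hc, star_algebraMap, ← map_mul, ← map_one (algebraMap ℝ _)] at h1
  have h2 := FaithfulSMul.algebraMap_injective ℝ (CliffordAlgebra (spinForm m)) h1
  rcases mul_self_eq_one_iff.mp h2 with h | h
  · left
    rw [← hc, h, map_one]
  · right
    rw [← hc, h, map_neg, map_one]

/-! ### Unit vectors and reflections -/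

theorem ι_mul_self_of_unit {m : ℕ} {a : Fin m → ℝ} (ha : a ⬝ᵥ a = 1) :
    ι (spinForm m) a * ι (spinForm m) a = -1 := by
  rw [ι_sq_scalar, spinForm_eq, ha, map_neg, map_one]

theorem ι_mem_pinGroup {m : ℕ} {a : Fin m → ℝ} (ha : a ⬝ᵥ a = 1) :
    ι (spinForm m) a ∈ pinGroup (spinForm m) := by
  have h1 : ι (spinForm m) a * -ι (spinForm m) a = 1 := by
    rw [mul_neg, ι_mul_self_of_unit ha, neg_neg]
  have h2 : -ι (spinForm m) a * ι (spinForm m) a = 1 := by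
    rw [neg_mul, ι_mul_self_of_unit ha, neg_neg]
  rw [pinGroup.mem_iff]
  refine ⟨⟨⟨ι (spinForm m) a, -ι (spinForm m) a, h1, h2⟩, ?_, rfl⟩, ?_⟩
  · exact Subgroup.subset_closure ⟨a, rfl⟩
  · rw [Unitary.mem_iff, star_ι]
    exact ⟨h2, h1⟩

/-- The product of two unit vectors, as an element of the spin group. -/
noncomputable def pair {m : ℕ} (a b : Fin m → ℝ) (ha : a ⬝ᵥ a = 1) (hb : b ⬝ᵥ b = 1) : Spin m :=
  ⟨ι (spinForm m) a * ι (spinForm m) b, spinGroup.mem_iff.mpr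
    ⟨mul_mem (ι_mem_pinGroup ha) (ι_mem_pinGroup hb), ι_mul_ι_mem_evenOdd_zero _ a b⟩⟩

/-- The matrix of the reflection in the hyperplane orthogonal to a unit vector. -/
def reflMatrix {m : ℕ} (a : Fin m → ℝ) : Matrix (Fin m) (Fin m) ℝ :=
  1 - (2 : ℝ) • Matrix.vecMulVec a a

theorem reflMatrix_mulVec {m : ℕ} (a v : Fin m → ℝ) :
    (reflMatrix a).mulVec v = v - (2 * (a ⬝ᵥ v)) • a := by
  rw [reflMatrix, Matrix.sub_mulVec, Matrix.one_mulVec, Matrix.smul_mulVec,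
    Matrix.vecMulVec_mulVec, op_smul_eq_smul, mul_smul]

/-- Since a² = -1, the inverse of a is -a, so a v a = -a v a⁻¹ is the reflection itself, with no
extra sign. -/
theorem ι_reflMatrix_mulVec {m : ℕ} {a : Fin m → ℝ} (ha : a ⬝ᵥ a = 1) (v : Fin m → ℝ) :
    ι (spinForm m) ((reflMatrix a).mulVec v) =
      ι (spinForm m) a * ι (spinForm m) v * ι (spinForm m) a := by
  have h : ι (spinForm m) a * ι (spinForm m) v =
      algebraMap ℝ _ (-2 * (a ⬝ᵥ v)) - ι (spinForm m) v * ι (spinForm m) a := by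
    rw [← polar_spinForm, ← ι_mul_ι_add_swap, add_sub_cancel_right]
  rw [h, sub_mul, mul_assoc, ι_mul_self_of_unit ha, reflMatrix_mulVec, map_sub, map_smul,
    ← Algebra.smul_def, neg_mul, neg_smul]
  noncomm_ring

theorem coe_toSO_pair {m : ℕ} {a b : Fin m → ℝ} (ha : a ⬝ᵥ a = 1) (hb : b ⬝ᵥ b = 1) :
    (toSO m (pair a b ha hb) : Matrix (Fin m) (Fin m) ℝ) = reflMatrix a * reflMatrix b := by
  apply sandwich_eq
  intro v
  rw [← Matrix.mulVec_mulVec, ι_reflMatrix_mulVec ha, ι_reflMatrix_mulVec hb]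
  simp [pair, mul_assoc]

theorem det_reflMatrix {m : ℕ} {a : Fin m → ℝ} (ha : a ⬝ᵥ a = 1) : (reflMatrix a).det = -1 := by
  have h : reflMatrix a = 1 + Matrix.replicateCol Unit a *
      Matrix.replicateRow Unit ((-2 : ℝ) • a) := by
    ext i j
    simp [reflMatrix, Matrix.mul_apply, Matrix.vecMulVec_apply]
    ring
  rw [h, Matrix.det_one_add_replicateCol_mul_replicateRow, smul_dotProduct, ha]
  norm_num

theorem reflMatrix_mul_self {m : ℕ} {a : Fin m → ℝ} (ha : a ⬝ᵥ a = 1) :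
    reflMatrix a * reflMatrix a = 1 := by
  apply Matrix.toLin'.injective
  apply LinearMap.ext
  intro v
  rw [Matrix.toLin'_apply, Matrix.toLin'_one, ← Matrix.mulVec_mulVec, reflMatrix_mulVec,
    reflMatrix_mulVec, dotProduct_sub, dotProduct_smul, ha, LinearMap.id_apply, sub_sub,
    ← add_smul]
  simp
  left
  ring

/-- Every orthogonal matrix is a product of at most `m` reflections. -/
theorem exists_list_reflMatrix {m : ℕ} (A : Matrix (Fin m) (Fin m) ℝ)
    (hA : A ∈ Matrix.orthogonalGroup (Fin m) ℝ) :
    ∃ l : List {a : Fin m → ℝ // a ⬝ᵥ a = 1}, l.length ≤ m ∧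
      A = (l.map fun a => reflMatrix a.1).prod := by
  let T := Matrix.toLpLin 2 2 A
  have hT : ∀ v w, inner ℝ (T v) (T w) = inner ℝ v w := by
    intro v w
    rw [EuclideanSpace.inner_eq_star_dotProduct, EuclideanSpace.inner_eq_star_dotProduct]
    simp only [T, Matrix.ofLp_toLpLin, star_trivial, Matrix.toLin'_apply]
    rw [Matrix.dotProduct_mulVec, Matrix.vecMul_mulVec,
      (Matrix.mem_orthogonalGroup_iff' _ _).mp hA, Matrix.vecMul_one]
  let φ := (LinearMap.isometryOfInner T hT).toLinearIsometryEquiv rfl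
  obtain ⟨l, hl, hφ⟩ := φ.reflections_generate_dim
  rw [finrank_euclideanSpace_fin] at hl
  -- The vectors from Cartan–Dieudonné are arbitrary: a zero vector gives the identity and is
  -- dropped, the others are normalized.
  have key : ∀ l : List (EuclideanSpace ℝ (Fin m)), ∃ l' : List {a : Fin m → ℝ // a ⬝ᵥ a = 1},
      l'.length ≤ l.length ∧ ∀ v,
        (l.map fun v => (ℝ ∙ v)ᗮ.reflection).prod v =
          WithLp.toLp 2 ((l'.map fun a => reflMatrix a.1).prod.mulVec (WithLp.ofLp v)) := by
    intro l
    induction l with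
    | nil => exact ⟨[], le_rfl, by simp⟩
    | cons u l ih =>
      obtain ⟨l', h1, h2⟩ := ih
      by_cases hu : u = 0
      · refine ⟨l', h1.trans (by simp), fun v => ?_⟩
        rw [List.map_cons, List.prod_cons, LinearIsometryEquiv.coe_mul, Function.comp_apply, h2]
        refine Submodule.reflection_mem_subspace_eq_self ?_
        simp [hu]
      · have hn : ‖u‖ ≠ 0 := norm_ne_zero_iff.mpr hu
        have huu : WithLp.ofLp u ⬝ᵥ WithLp.ofLp u = ‖u‖ ^ 2 := by
          rw [← real_inner_self_eq_norm_sq, EuclideanSpace.inner_eq_star_dotProduct, star_trivial]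
        have ha : (‖u‖⁻¹ • WithLp.ofLp u) ⬝ᵥ (‖u‖⁻¹ • WithLp.ofLp u) = 1 := by
          rw [smul_dotProduct, dotProduct_smul, huu, smul_eq_mul, smul_eq_mul]
          field_simp
        refine ⟨⟨‖u‖⁻¹ • WithLp.ofLp u, ha⟩ :: l', by simpa using h1, fun v => ?_⟩
        rw [List.map_cons, List.prod_cons, LinearIsometryEquiv.coe_mul, Function.comp_apply, h2,
          List.map_cons, List.prod_cons, ← Matrix.mulVec_mulVec, reflMatrix_mulVec,
          Submodule.reflection_orthogonal_apply, Submodule.reflection_singleton_apply,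
          EuclideanSpace.inner_eq_star_dotProduct, star_trivial]
        ext i
        simp [dotProduct_comm]
        field_simp
  obtain ⟨l', h1, h2⟩ := key l
  refine ⟨l', h1.trans hl, ?_⟩
  apply Matrix.toLin'.injective
  apply LinearMap.ext
  intro v
  have h3 := h2 (WithLp.toLp 2 v)
  rw [← hφ] at h3
  exact congrArg WithLp.ofLp h3

end Spin

/-! ### `SO m` as a compact quotient, and descent of representations -/

namespace Spin

/-- Each reflection has determinant -1, so a rotation uses an even number of them, which can be
grouped in consecutive pairs. Only a uniform bound on the number of pairs matters, so `m` suffices.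
-/
theorem exists_list_pair {m : ℕ} (A : SO m) :
    ∃ l : List ({a : Fin m → ℝ // a ⬝ᵥ a = 1} × {a : Fin m → ℝ // a ⬝ᵥ a = 1}), l.length ≤ m ∧
      A = toSO m (l.map fun p => pair p.1.1 p.2.1 p.1.2 p.2.2).prod := by
  have key : ∀ (n : ℕ) (l : List {a : Fin m → ℝ // a ⬝ᵥ a = 1}), l.length = 2 * n →
      ∃ l' : List ({a : Fin m → ℝ // a ⬝ᵥ a = 1} × {a : Fin m → ℝ // a ⬝ᵥ a = 1}),
      l'.length = n ∧ (l.map fun a => reflMatrix a.1).prod =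
        toSO m (l'.map fun p => pair p.1.1 p.2.1 p.1.2 p.2.2).prod := by
    intro n
    induction n with
    | zero =>
      intro l hl
      rw [List.eq_nil_of_length_eq_zero hl]
      exact ⟨[], rfl, by simp⟩
    | succ n ih =>
      intro l hl
      match l, hl with
      | a :: b :: l, hl =>
        obtain ⟨l', h1, h2⟩ := ih l (by simp only [List.length_cons] at hl; omega)
        refine ⟨(a, b) :: l', by simp [h1], ?_⟩
        rw [List.map_cons, List.map_cons, List.prod_cons, List.prod_cons, h2, List.map_cons,
          List.prod_cons, map_mul, Submonoid.coe_mul, coe_toSO_pair, mul_assoc]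
  obtain ⟨h1, h2⟩ := Matrix.mem_specialOrthogonalGroup_iff.mp A.2
  obtain ⟨l, hl, hA⟩ := exists_list_reflMatrix A.1 h1
  have hdet : ∀ l : List {a : Fin m → ℝ // a ⬝ᵥ a = 1},
      (l.map fun a => reflMatrix a.1).prod.det = (-1) ^ l.length := by
    intro l
    induction l with
    | nil => simp
    | cons a l ih =>
      rw [List.map_cons, List.prod_cons, Matrix.det_mul, ih, det_reflMatrix a.2, List.length_cons,
        pow_succ']
  have heven : Even l.length := by
    rw [hA, hdet] at h2
    exact (neg_one_pow_eq_one_iff_even (by norm_num)).mp h2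
  obtain ⟨n, hn⟩ := heven
  obtain ⟨l', h3, h4⟩ := key n l (by omega)
  exact ⟨l', by omega, Subtype.ext (hA.trans h4)⟩

/-- The product of `m` products of two unit vectors. -/
noncomputable def pairProd {m : ℕ}
    (f : Fin m → {a : Fin m → ℝ // a ⬝ᵥ a = 1} × {a : Fin m → ℝ // a ⬝ᵥ a = 1}) : Spin m :=
  (List.ofFn fun i => pair (f i).1.1 (f i).2.1 (f i).1.2 (f i).2.2).prod

theorem toSO_pairProd_surjective {m : ℕ} (hm : 0 < m) :
    Function.Surjective fun f : Fin m → {a : Fin m → ℝ // a ⬝ᵥ a = 1} × _ =>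
      toSO m (pairProd f) := by
  intro A
  obtain ⟨l, hl, hA⟩ := exists_list_pair A
  let e : {a : Fin m → ℝ // a ⬝ᵥ a = 1} := ⟨Pi.single ⟨0, hm⟩ 1, by simp⟩
  have he : toSO m (pair e.1 e.1 e.2 e.2) = 1 :=
    Subtype.ext (by rw [coe_toSO_pair, reflMatrix_mul_self e.2]; rfl)
  -- Padding to length exactly `m` with (e, e): this pair may change the spin element by a sign but
  -- has trivial image in `SO m`.
  let l' := l ++ List.replicate (m - l.length) (e, e)
  have hl' : l'.length = m := by simp [l', hl]
  refine ⟨fun i => l'.get (i.cast hl'.symm), ?_⟩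
  have h : (List.ofFn fun i : Fin m => l'.get (i.cast hl'.symm)) = l' := by
    apply List.ext_get <;> simp [hl']
  have h2 : (List.ofFn fun i : Fin m => (fun p : {a : Fin m → ℝ // a ⬝ᵥ a = 1} ×
      {a : Fin m → ℝ // a ⬝ᵥ a = 1} => pair p.1.1 p.2.1 p.1.2 p.2.2) (l'.get (i.cast hl'.symm))) =
      l'.map fun p => pair p.1.1 p.2.1 p.1.2 p.2.2 := by
    conv_rhs => rw [← h, List.map_ofFn]
    rfl
  refine (congrArg (fun l : List (Spin m) => toSO m l.prod) h2).trans ?_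
  simp only [l', List.map_append, List.map_replicate, List.prod_append, List.prod_replicate,
    map_mul, map_pow, he, one_pow, mul_one]
  exact hA.symm

/-- Left multiplication by a vector is a combination of fixed linear maps with the coordinates as
coefficients, and linear maps are continuous for the module topology. Joint continuity of the
Clifford product is not needed. -/
theorem continuous_coe_list_ofFn_prod {m n : ℕ} {X : Type*} [TopologicalSpace X]
    (f : Fin n → X → (Fin m → ℝ) × (Fin m → ℝ)) (hf : ∀ i, Continuous (f i)) :
    @Continuous X (CliffordAlgebra (spinForm m)) _ (moduleTopology ℝ _) fun x =>
      (List.ofFn fun i => ι (spinForm m) (f i x).1 * ι (spinForm m) (f i x).2).prod := by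
  let _ : TopologicalSpace (CliffordAlgebra (spinForm m)) := moduleTopology ℝ _
  have : ContinuousAdd (CliffordAlgebra (spinForm m)) := IsModuleTopology.toContinuousAdd ℝ _
  have hmul : ∀ (a : X → Fin m → ℝ) (g : X → CliffordAlgebra (spinForm m)), Continuous a →
      Continuous g → Continuous fun x => ι (spinForm m) (a x) * g x := by
    intro a g ha hg
    have h : (fun x => ι (spinForm m) (a x) * g x) = fun x => ∑ i, a x i •
        LinearMap.mulLeft ℝ (ι (spinForm m) (Pi.single i 1)) (g x) := by
      funext x
      conv_lhs => rw [pi_eq_sum_univ' (a x)]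
      rw [map_sum, Finset.sum_mul]
      refine Finset.sum_congr rfl fun i _ => ?_
      rw [map_smul, smul_mul_assoc, LinearMap.mulLeft_apply]
    rw [h]
    exact continuous_finsetSum _ fun i _ => ((continuous_apply i).comp ha).smul
      ((IsModuleTopology.continuous_of_linearMap _).comp hg)
  induction n with
  | zero => simpa using continuous_const
  | succ n ih =>
    simp only [List.ofFn_succ, List.prod_cons, mul_assoc]
    exact hmul _ _ (hf 0).fst (hmul _ _ (hf 0).snd (ih _ fun i => hf i.succ))

theorem continuous_pairProd (m : ℕ) : Continuous (pairProd (m := m)) := by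
  let _ : TopologicalSpace (CliffordAlgebra (spinForm m)) := moduleTopology ℝ _
  refine continuous_induced_rng.mpr ?_
  have h := continuous_coe_list_ofFn_prod (m := m) (n := m) (fun i
    (f : Fin m → {a : Fin m → ℝ // a ⬝ᵥ a = 1} × {a : Fin m → ℝ // a ⬝ᵥ a = 1}) =>
      ((f i).1.1, (f i).2.1)) (fun i => by fun_prop)
  convert h using 1
  funext f
  simp only [Function.comp_apply, pairProd]
  rw [Submonoid.coe_list_prod, List.map_ofFn]
  rfl

theorem continuous_toSO_pairProd (m : ℕ) :
    Continuous fun f => toSO m (pairProd (m := m) f) := by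
  refine Continuous.subtype_mk (f := fun f => (toSO m (pairProd (m := m) f)).1) ?_ _
  have h : (fun f => (toSO m (pairProd (m := m) f)).1) = fun f =>
      (List.ofFn fun i => reflMatrix (f i).1.1 * reflMatrix (f i).2.1).prod := by
    funext f
    rw [pairProd, map_list_prod, Submonoid.coe_list_prod, List.map_ofFn, List.map_ofFn]
    congr 2
    funext i
    exact coe_toSO_pair _ _
  rw [h]
  simp only [List.ofFn_eq_map]
  refine continuous_list_prod _ fun i _ => ?_
  unfold reflMatrix
  fun_prop

instance compactSpace_unit (m : ℕ) : CompactSpace {a : Fin m → ℝ // a ⬝ᵥ a = 1} := by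
  refine isCompact_iff_compactSpace.mp (?_ : IsCompact {a : Fin m → ℝ | a ⬝ᵥ a = 1})
  refine Metric.isCompact_of_isClosed_isBounded
    (isClosed_eq (by unfold dotProduct; fun_prop) continuous_const)
    (isBounded_iff_forall_norm_le.mpr ⟨1, fun a ha => ?_⟩)
  refine (pi_norm_le_iff_of_nonneg zero_le_one).mpr fun i => ?_
  have h : a i * a i ≤ 1 := by
    rw [← show a ⬝ᵥ a = 1 from ha]
    exact Finset.single_le_sum (f := fun i => a i * a i) (fun j _ => mul_self_nonneg (a j))
      (Finset.mem_univ i)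
  rw [Real.norm_eq_abs]
  exact abs_le_one_iff_mul_self_le_one.mpr h

/-- A continuous surjection from a compact space to a Hausdorff space is closed, hence a quotient
map. Continuity on `SO m` can thus be tested on tuples of unit vectors. -/
theorem isQuotientMap_toSO_pairProd {m : ℕ} (hm : 0 < m) :
    Topology.IsQuotientMap fun f => toSO m (pairProd (m := m) f) :=
  (continuous_toSO_pairProd m).isClosedMap.isQuotientMap (continuous_toSO_pairProd m)
    (toSO_pairProd_surjective hm)

theorem toSO_surjective {m : ℕ} (hm : 0 < m) : Function.Surjective (toSO m) := fun A =>
  let ⟨f, hf⟩ := toSO_pairProd_surjective hm A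
  ⟨pairProd f, hf⟩

/-- A continuous representation whose kernel contains that of the covering homomorphism factors
through `SO_m`. -/
theorem factorsThroughSO_of_ker {m : ℕ} (hm : 0 < m) {V : Type*} [AddCommGroup V] [Module ℂ V]
    [TopologicalSpace V] (ρ : Representation ℂ (Spin m) V) (hcont : ρ.IsContinuousRep)
    (hker : ∀ x, toSO m x = 1 → ρ x = 1) : FactorsThroughSO ρ := by
  have hρ : ∀ x y, toSO m x = toSO m y → ρ x = ρ y := by
    intro x y h
    have h1 : ρ (x * y⁻¹) = 1 := hker _ (by rw [map_mul, map_inv, h, mul_inv_cancel])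
    calc ρ x = ρ (x * y⁻¹ * y) := by rw [inv_mul_cancel_right]
      _ = ρ y := by rw [map_mul, h1, one_mul]
  have hs := Function.surjInv_eq (toSO_surjective hm)
  -- The set-theoretic section need not be continuous: by `hρ` the choice of lift is immaterial, and
  -- continuity is checked through the quotient map.
  let σ : Representation ℂ (SO m) V :=
    { toFun := fun A => ρ (Function.surjInv (toSO_surjective hm) A)
      map_one' := hker _ (hs 1)
      map_mul' := fun A B => by
        rw [← map_mul]
        exact hρ _ _ (by rw [map_mul, hs, hs, hs]) }
  have hσ : ∀ x, ρ x = σ (toSO m x) := fun x => hρ _ _ (hs _).symm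
  refine ⟨σ, fun v => ?_, hσ⟩
  rw [(isQuotientMap_toSO_pairProd hm).continuous_iff]
  have h : (fun A => σ A v) ∘ (fun f => toSO m (pairProd (m := m) f)) =
      (fun x => ρ x v) ∘ pairProd := by
    funext f
    exact (congrArg (· v) (hσ (pairProd f))).symm
  rw [h]
  exact (hcont v).comp (continuous_pairProd m)

end Spin

/-! ### Central involutions, anticommuting operators and the conclusion -/

/-- A central involution acts by `±1` on an irreducible representation. -/
theorem Representation.IsIrreducible.eq_one_or_eq_neg_one {k G V : Type*} [Field k] [Group G]
    [AddCommGroup V] [Module k V] {ρ : Representation k G V} (hirr : ρ.IsIrreducible) (z : G)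
    (hz : z * z = 1) (hcomm : ∀ g, z * g = g * z) : ρ z = 1 ∨ ρ z = -1 := by
  have hzz : ∀ v, ρ z (ρ z v) = v := fun v => by
    rw [← Module.End.mul_apply, ← map_mul, hz, map_one, Module.End.one_apply]
  -- The +1 eigenspace of `ρ z`, invariant because `z` is central. It contains every ρ(z)v + v, so
  -- if it is zero then ρ(z) = -1.
  let W : Subrepresentation ρ :=
    { toSubmodule := LinearMap.ker (ρ z - 1)
      apply_mem_toSubmodule := fun g v hv => by
        rw [LinearMap.mem_ker, LinearMap.sub_apply, sub_eq_zero, Module.End.one_apply] at hv ⊢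
        rw [← Module.End.mul_apply, ← map_mul, hcomm, map_mul, Module.End.mul_apply, hv] }
  have hmem : ∀ v, v ∈ W ↔ ρ z v = v := fun v => by
    change v ∈ LinearMap.ker (ρ z - 1) ↔ _
    rw [LinearMap.mem_ker, LinearMap.sub_apply, sub_eq_zero, Module.End.one_apply]
  rcases hirr.eq_bot_or_eq_top W with h | h
  · right
    ext v
    have hv : ρ z v + v ∈ W := by rw [hmem, map_add, hzz, add_comm]
    rw [h] at hv
    exact eq_neg_of_add_eq_zero_left hv
  · left
    ext v
    have hv : v ∈ W := by rw [h]; trivial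
    exact (hmem v).mp hv

/-- Two anticommuting invertible operators exist only in even dimension. -/
theorem even_finrank_of_anticommute {k V : Type*} [Field k] [CharZero k] [AddCommGroup V]
    [Module k V] (A B : V →ₗ[k] V) (hA : IsUnit A) (hB : IsUnit B)
    (h : A * B = -(B * A)) : Even (Module.finrank k V) := by
  have h1 := congrArg LinearMap.det h
  rw [← neg_one_smul k, LinearMap.det_smul, map_mul, map_mul, mul_comm (LinearMap.det B)] at h1
  have h2 : LinearMap.det A * LinearMap.det B ≠ 0 :=
    mul_ne_zero (hA.map LinearMap.det).ne_zero (hB.map LinearMap.det).ne_zero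
  have h3 : (-1 : k) ^ Module.finrank k V = 1 := (right_eq_mul₀ h2).mp h1
  exact (neg_one_pow_eq_one_iff_even (by norm_num)).mp h3

theorem mainTheorem9 (m : ℕ) (hm : 3 ≤ m) {V : Type*} [AddCommGroup V] [Module ℂ V]
    [FiniteDimensional ℂ V] [TopologicalSpace V] [IsTopologicalAddGroup V] [ContinuousSMul ℂ V]
    [T2Space V] (ρ : Representation ℂ (Spin m) V) (hcont : ρ.IsContinuousRep)
    (hirr : ρ.IsIrreducible) (hfac : ¬ Spin.FactorsThroughSO ρ) :
    Even (Module.finrank ℂ V) := by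
  let e : Fin 3 → Fin m → ℝ := fun i => Pi.single (i.castLE hm) 1
  have he : ∀ i, e i ⬝ᵥ e i = 1 := fun i => by simp [e]
  have hsq : ∀ i, ι (spinForm m) (e i) * ι (spinForm m) (e i) = -1 := fun i =>
    Spin.ι_mul_self_of_unit (he i)
  have hanti : ∀ i j, i ≠ j → ι (spinForm m) (e i) * ι (spinForm m) (e j) =
      -(ι (spinForm m) (e j) * ι (spinForm m) (e i)) := by
    intro i j hij
    refine eq_neg_of_add_eq_zero_left ?_
    rw [ι_mul_ι_add_swap, Spin.polar_spinForm]
    simp [e, hij]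
  -- The element -1 of the spin group, written as e₀e₀.
  let z : Spin m := Spin.pair (e 0) (e 0) (he 0) (he 0)
  have hz : (z : CliffordAlgebra (spinForm m)) = -1 := hsq 0
  -- These two products share exactly one vector, which is why they anticommute.
  let x : Spin m := Spin.pair (e 0) (e 1) (he 0) (he 1)
  let y : Spin m := Spin.pair (e 1) (e 2) (he 1) (he 2)
  have hxy : x * y = z * (y * x) := by
    apply Subtype.ext
    rw [Submonoid.coe_mul, Submonoid.coe_mul, Submonoid.coe_mul, hz]
    change ι (spinForm m) (e 0) * ι (spinForm m) (e 1) *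
      (ι (spinForm m) (e 1) * ι (spinForm m) (e 2)) = -1 * (ι (spinForm m) (e 1) *
      ι (spinForm m) (e 2) * (ι (spinForm m) (e 0) * ι (spinForm m) (e 1)))
    have h01 := hanti 0 1 (by decide)
    have h02 := hanti 0 2 (by decide)
    have h12 := hanti 1 2 (by decide)
    have h11 := hsq 1
    generalize ι (spinForm m) (e 0) = a at h01 h02 ⊢
    generalize ι (spinForm m) (e 1) = b at h01 h12 h11 ⊢
    generalize ι (spinForm m) (e 2) = c at h02 h12 ⊢
    calc a * b * (b * c) = a * (b * b) * c := by noncomm_ring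
      _ = -1 * (b * b * (c * a)) := by rw [h11, mul_neg_one, neg_mul, h02]; noncomm_ring
      _ = -1 * (b * (b * c) * a) := by noncomm_ring
      _ = -1 * (b * c * -(b * a)) :=
        (congrArg (fun t => -1 * (b * t * a)) h12).trans (by noncomm_ring)
      _ = -1 * (b * c * (a * b)) := by rw [h01]
  rcases hirr.eq_one_or_eq_neg_one z (Subtype.ext (by simp [hz]))
    (fun g => Subtype.ext (by simp [hz])) with h | h
  · refine absurd (Spin.factorsThroughSO_of_ker (by omega) ρ hcont fun g hg => ?_) hfac
    rcases Spin.eq_one_or_eq_neg_one_of_toSO_eq_one hg with h1 | h1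
    · rw [show g = 1 from Subtype.ext h1, map_one]
    · rw [show g = z from Subtype.ext (h1.trans hz.symm), h]
  · refine even_finrank_of_anticommute (ρ x) (ρ y) ((Group.isUnit x).map ρ)
      ((Group.isUnit y).map ρ) ?_
    rw [← map_mul, hxy, map_mul, map_mul, h, neg_one_mul]
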